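/- A \emph{lattice} is a free abelian group of finite rank with a symmetric integral bilinear form; all lattices are even. A \emph{$D$-polarized lattice} $S\ni h$ is a non-degenerate even lattice $S$ with positive inertia index $1$ and a distinguished vector $h$ with $h^2=D>0$. It is \emph{admissible} if there is no $e\in S$ with $e^2=-2$, $e\cdot h=0$ and no $e\in S$ with $e^2=0$, $e\cdot h=2$. It is \emph{geometric} if, moreover, it admits a primitive isometry to the $K3$-lattice $2\mathbf E_8\oplus 3\mathbf U$ ($\mathbf E_8$ negative definite, $\mathbf U$ the hyperbolic plane). If $\Gamma\subset S$ is a set of vectors $v$ with $v^2=-2$, $v\cdot h=d$, then $S$ is \emph{$\Gamma$-admissible} (respectively, \emph{$\Gamma$-geometric}) if it is admissible (respectively, geometric) and, for each integer $1\le r<d$, there is no $e\in S$ with $e^2=-2$, $e\cdot h=r$ and $e\cdot v<0$ for some $v\in\Gamma$. For a finite loop-free multigraph $\Gamma$, let $\mathbb Z\Gamma+\mathbb Zh$ be the free abelian group on the vertices of $\Gamma$ and $h$, with the form given by $v^2=-2$, $u\cdot v=$ the number of edges joining $u\neq v$, $h^2=D$, $h\cdot v=d$; let $\mathcal F_D^d(\Gamma)\ni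 h$ be its quotient by the radical. The graph $\Gamma$ is \emph{admissible in degree $D$ with respect to $d$} if $\mathcal F_D^d(\Gamma)$ is a $\Gamma$-admissible $D$-polarized lattice, and an admissible graph $\Gamma$ is \emph{subgeometric in degree $D$ with respect to $d$} if $\mathcal F_D^d(\Gamma)$ has a $\Gamma$-geometric even finite index extension. Let $\Gamma=5\tilde A_3+2A_1$ be the disjoint union of five simple $4$-cycles and two isolated vertices. \textbf{Proposition.} For every odd integer $d>1$ there is an integer $N=N(d)$ such that, for every odd integer $n\ge N$, the graph $\Gamma$ is not subgeometric in degree $2n$ with respect to $d$. -/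

import Mathlib

namespace K3Graphs

/-! ### Even lattices, polarizations, and the K3-lattice -/

/-- A non-degenerate even hyperbolic lattice: a free abelian group of finite rank with a
non-degenerate symmetric even integral form of positive inertia index `1`.  (The maximal rank of a
positive definite subgroup is the positive inertia index of the form over `ℝ`.) -/
structure IsHyperbolicLattice {S : Type*} [AddCommGroup S] (B : LinearMap.BilinForm ℤ S) :
    Prop where
  free : Module.Free ℤ S
  finite : Module.Finite ℤ S
  symm : ∀ x y, B x y = B y x
  even : ∀ x, Even (B x x)
  nondegenerate : B.Nondegenerate
  hyperbolic : sigPos (LinearMap.BilinMap.toQuadraticMap B) = 1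

/-- `S ∋ h` is a `D`-polarized lattice. -/
structure IsPolarizedLattice {S : Type*} [AddCommGroup S] (B : LinearMap.BilinForm ℤ S) (h : S)
    (D : ℤ) : Prop extends IsHyperbolicLattice B where
  degree_pos : 0 < D
  degree_eq : B h h = D

/-- Gram matrix of the hyperbolic plane `U`. -/
def gramU : Matrix (Fin 2) (Fin 2) ℤ := !![0, 1; 1, 0]

/-- Index set of the standard basis of `2 E₈ ⊕ 3 U`. -/
abbrev K3Index : Type := (Fin 8 × Fin 2) ⊕ (Fin 2 × Fin 3)

/-- Gram matrix of the K3-lattice `2 E₈ ⊕ 3 U`, where `E₈` is negative definite. -/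
def gramK3 : Matrix K3Index K3Index ℤ :=
  Matrix.fromBlocks (Matrix.blockDiagonal fun _ : Fin 2 => -CartanMatrix.E₈) 0
    0 (Matrix.blockDiagonal fun _ : Fin 3 => gramU)

/-- The intersection form of the K3-lattice on `ℤ²²`. -/
noncomputable def formK3 : LinearMap.BilinForm ℤ (K3Index → ℤ) := Matrix.toBilin' gramK3

/-- The lattice `S` admits a primitive isometry (an injective form-preserving homomorphism with
torsion-free cokernel) to the K3-lattice. -/
def HasPrimitiveIsometryToK3 {S : Type*} [AddCommGroup S] (B : LinearMap.BilinForm ℤ S) : Prop :=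
  ∃ φ : S →ₗ[ℤ] (K3Index → ℤ), Function.Injective φ ∧ (∀ x y, formK3 (φ x) (φ y) = B x y) ∧
    ∀ (m : ℤ) (y : K3Index → ℤ), m ≠ 0 → m • y ∈ LinearMap.range φ → y ∈ LinearMap.range φ

/-! ### Admissible and geometric polarized lattices -/

/-- The set `root_r(S, h)` of `(-2)`-vectors of degree `r`. -/
def roots {S : Type*} [AddCommGroup S] (B : LinearMap.BilinForm ℤ S) (h : S) (r : ℤ) : Set S :=
  {e | B e e = -2 ∧ B e h = r}

/-- There are neither exceptional divisors nor `2`-isotropic vectors. -/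
def IsAdmissible {S : Type*} [AddCommGroup S] (B : LinearMap.BilinForm ℤ S) (h : S) : Prop :=
  ∀ e : S, ¬ (B e e = -2 ∧ B e h = 0) ∧ ¬ (B e e = 0 ∧ B e h = 2)

/-- An admissible lattice is geometric if it admits a primitive isometry to the K3-lattice. -/
def IsGeometric {S : Type*} [AddCommGroup S] (B : LinearMap.BilinForm ℤ S) (h : S) : Prop :=
  IsAdmissible B h ∧ HasPrimitiveIsometryToK3 B

/-- There is no `𝒢`-inadmissible root of degree `1 ≤ r < d`. -/
def NoInadmissibleRoot {S : Type*} [AddCommGroup S] (B : LinearMap.BilinForm ℤ S) (h : S) (d : ℤ)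
    (𝒢 : Set S) : Prop :=
  ∀ r : ℤ, 1 ≤ r → r < d → ∀ e ∈ roots B h r, ¬ ∃ v ∈ 𝒢, B e v < 0

/-- `S ∋ h` is `𝒢`-admissible, where `𝒢` is a set of roots of degree `d`. -/
def IsGraphAdmissible {S : Type*} [AddCommGroup S] (B : LinearMap.BilinForm ℤ S) (h : S) (d : ℤ)
    (𝒢 : Set S) : Prop :=
  𝒢 ⊆ roots B h d ∧ IsAdmissible B h ∧ NoInadmissibleRoot B h d 𝒢

/-- `S ∋ h` is `𝒢`-geometric, where `𝒢` is a set of roots of degree `d`. -/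
def IsGraphGeometric {S : Type*} [AddCommGroup S] (B : LinearMap.BilinForm ℤ S) (h : S) (d : ℤ)
    (𝒢 : Set S) : Prop :=
  𝒢 ⊆ roots B h d ∧ IsGeometric B h ∧ NoInadmissibleRoot B h d 𝒢

/-! ### Loop-free multigraphs -/

/-- A loop-free undirected multigraph: `mult u v` is the number of edges joining `u` and `v`. -/
structure Multigraph (V : Type*) where
  mult : V → V → ℕ
  symm : ∀ u v, mult u v = mult v u
  loopless : ∀ v, mult v v = 0

namespace Multigraph

/-- A simple graph as a multigraph. -/
def ofSimple {V : Type*} (G : SimpleGraph V) [DecidableRel G.Adj] : Multigraph V where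
  mult u v := if G.Adj u v then 1 else 0
  symm u v := by simp only [G.adj_comm]
  loopless v := by simp

/-- The disjoint union of two graphs. -/
def sum {V W : Type*} (G : Multigraph V) (H : Multigraph W) : Multigraph (V ⊕ W) where
  mult
    | .inl u, .inl v => G.mult u v
    | .inr u, .inr v => H.mult u v
    | _, _ => 0
  symm u v := by rcases u with u | u <;> rcases v with v | v <;> first | exact G.symm u v | exact H.symm u v | rfl
  loopless v := by rcases v with v | v <;> simp [G.loopless, H.loopless]

/-- The disjoint union of `m` copies of a graph. -/
def copies {V : Type*} (m : ℕ) (G : Multigraph V) : Multigraph (Fin m × V) where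
  mult u v := if u.1 = v.1 then G.mult u.2 v.2 else 0
  symm u v := by simp only [G.symm u.2 v.2, eq_comm (a := u.1)]
  loopless v := by simp [G.loopless]

end Multigraph

/-- The affine Dynkin diagram `Ã₃`: a simple `4`-cycle. -/
def affineA3 : Multigraph (Fin 4) := Multigraph.ofSimple (SimpleGraph.cycleGraph 4)

/-- The Dynkin diagram `A₁`: a single vertex. -/
def dynkinA1 : Multigraph (Fin 1) := Multigraph.ofSimple (⊥ : SimpleGraph (Fin 1))

/-- The graph `5Ã₃ + 2A₁`. -/
def graph5A3plus2A1 : Multigraph ((Fin 5 × Fin 4) ⊕ (Fin 2 × Fin 1)) :=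
  (Multigraph.copies 5 affineA3).sum (Multigraph.copies 2 dynkinA1)

/-! ### The polarized lattice of a graph -/

namespace Multigraph

universe u

variable {V : Type u} [DecidableEq V]

/-- Gram matrix of `ℤΓ + ℤh`: the index `some v` stands for the vertex `v`, and `none` for `h`. -/
def gram (G : Multigraph V) (D d : ℤ) : Matrix (Option V) (Option V) ℤ
  | none, none => D
  | none, some _ => d
  | some _, none => d
  | some u, some v => if u = v then -2 else (G.mult u v : ℤ)

theorem gram_comm (G : Multigraph V) (D d : ℤ) (i j : Option V) :
    G.gram D d i j = G.gram D d j i := by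
  rcases i with _ | u <;> rcases j with _ | v <;> try rfl
  simp only [gram, G.symm u v, eq_comm (a := u)]

variable [Fintype V]

/-- The form on the free abelian group `ℤΓ + ℤh`. -/
noncomputable def preForm (G : Multigraph V) (D d : ℤ) : LinearMap.BilinForm ℤ (Option V → ℤ) :=
  Matrix.toBilin' (G.gram D d)

theorem preForm_comm (G : Multigraph V) (D d : ℤ) (x y : Option V → ℤ) :
    G.preForm D d x y = G.preForm D d y x := by
  simp only [preForm, Matrix.toBilin'_apply]
  rw [Finset.sum_comm]
  refine Finset.sum_congr rfl fun i _ => Finset.sum_congr rfl fun j _ => ?_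
  rw [G.gram_comm D d j i]
  ring

theorem preForm_isRefl (G : Multigraph V) (D d : ℤ) : (G.preForm D d).IsRefl := fun x y hxy => by
  rw [← hxy]
  exact G.preForm_comm D d y x

/-- The group `(ℤΓ + ℤh) / ker`, the quotient by the radical of the form. -/
abbrev Fano (G : Multigraph V) (D d : ℤ) : Type u :=
  (Option V → ℤ) ⧸ LinearMap.ker (G.preForm D d)

/-- The induced form on `(ℤΓ + ℤh) / ker`. -/
noncomputable def fanoForm (G : Multigraph V) (D d : ℤ) : LinearMap.BilinForm ℤ (G.Fano D d) :=
  LinearMap.IsRefl.liftQ₂ (G.preForm D d) (LinearMap.ker (G.preForm D d))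
    (G.preForm_isRefl D d) le_rfl

/-- The class of a generator: of `h` for `none`, and of the vertex `v` for `some v`. -/
noncomputable def fanoGen (G : Multigraph V) (D d : ℤ) (i : Option V) : G.Fano D d :=
  Submodule.Quotient.mk (Pi.single i 1)

/-- The polarization `h` of the lattice of a graph. -/
noncomputable def fanoH (G : Multigraph V) (D d : ℤ) : G.Fano D d := G.fanoGen D d none

/-- The set of vertices of the graph, viewed in its lattice. -/
def fanoVertices (G : Multigraph V) (D d : ℤ) : Set (G.Fano D d) :=
  Set.range fun v : V => G.fanoGen D d (some v)

/-- The graph is admissible in degree `D` with respect to `d`. -/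
def Admissible (G : Multigraph V) (D d : ℤ) : Prop :=
  IsPolarizedLattice (G.fanoForm D d) (G.fanoH D d) D ∧
    IsGraphAdmissible (G.fanoForm D d) (G.fanoH D d) d (G.fanoVertices D d)

/-- The graph is subgeometric in degree `D` with respect to `d`: it is admissible, and its lattice
has a finite index extension `ι : Fano ↪ S` by an even lattice `S` that is geometric relative to
the vertices of the graph. -/
def Subgeometric (G : Multigraph V) (D d : ℤ) : Prop :=
  G.Admissible D d ∧
    ∃ (S : Type u) (_ : AddCommGroup S) (B : LinearMap.BilinForm ℤ S) (ι : G.Fano D d →ₗ[ℤ] S),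
      Function.Injective ι ∧
      (∀ x y, B (ι x) (ι y) = G.fanoForm D d x y) ∧
      Finite (S ⧸ LinearMap.range ι) ∧
      IsPolarizedLattice B (ι (G.fanoH D d)) D ∧
      IsGraphGeometric B (ι (G.fanoH D d)) d (ι '' G.fanoVertices D d)

end Multigraph

end K3Graphs

/-! The obstruction is a congruence: if `d` is odd, a geometric extension forces `4 ∣ h²`, whereas
`h² = 2n` with `n` odd. Inside the K3-lattice `L`, take three consecutive vertices of each cycle,
the two isolated vertices and a cycle class `k`: 18 vectors. Modulo 2 their form has an
8-dimensional radical, spanned by the sums `a i 0 + a i 2`, the `v j` and `k`. As `L/2L` is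
non-degenerate of dimension 22, comparing the span with its orthogonal complement gives at least two
independent relations modulo 2, all inside the radical. Each relation is a binary word whose half
lies in `L`, hence in `S` by primitivity. Evenness and the absence of exceptional divisors leave few
possible weights, so the words form a code of dimension at most 2 (`finrank_halfKernel_le`).
Equality follows, a word on three cycles and both isolated vertices exists (`exists_weight_three`),
and the span is the full orthogonal complement of the radical. For the half `x` of that word, `h -
x` meets the radical evenly, so `h` is determined modulo `2L` by the configuration and `x`.
Computing `(2h)²` modulo 16 then yields `four_dvd_degree`. -/

namespace K3Graphs

open Module

/-! ### The K3-lattice and its reduction modulo 2. -/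

/-- The Gram matrix of the K3-lattice is unimodular. -/
theorem isUnit_det_gramK3 : IsUnit gramK3.det := by
  have hU : gramU.det = -1 := by simp [gramU, Matrix.det_fin_two]
  rw [gramK3, Matrix.det_fromBlocks_zero₁₂, Matrix.det_blockDiagonal, Matrix.det_blockDiagonal]
  simp [Matrix.det_neg, CartanMatrix.E₈_det, hU]

theorem gramK3_isSymm : gramK3.IsSymm := by
  have hU : gramU.transpose = gramU := by decide
  rw [Matrix.IsSymm, gramK3, Matrix.fromBlocks_transpose, Matrix.blockDiagonal_transpose,
    Matrix.blockDiagonal_transpose]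
  simp [hU, CartanMatrix.E₈_transpose]

theorem even_gramK3_diag (i : K3Index) : Even (gramK3 i i) := by
  rcases i with ⟨i, j⟩ | ⟨i, j⟩
  · simp [gramK3, Matrix.blockDiagonal_apply]
  · fin_cases i <;> simp [gramK3, Matrix.blockDiagonal_apply, gramU]

theorem formK3_comm (x y : K3Index → ℤ) : formK3 x y = formK3 y x := by
  simp only [formK3, Matrix.toBilin'_apply]
  rw [Finset.sum_comm]
  refine Finset.sum_congr rfl fun i _ => Finset.sum_congr rfl fun j _ => ?_
  rw [gramK3_isSymm.apply]
  ring

/-- Modulo 2 the cross term `2 x·y` disappears, so squaring is additive and it suffices to test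
multiples of basis vectors. -/
theorem even_formK3 (x : K3Index → ℤ) : Even (formK3 x x) := by
  let f : (K3Index → ℤ) →+ ZMod 2 :=
    { toFun := fun x => (formK3 x x : ZMod 2)
      map_zero' := by simp
      map_add' := fun x y => by
        simp only [map_add, LinearMap.add_apply, formK3_comm y x]
        push_cast
        linear_combination (formK3 x y : ZMod 2) * (by decide : (2 : ZMod 2) = 0) }
  have hf : f = 0 := by
    refine AddMonoidHom.functions_ext _ _ _ fun i m => ?_
    obtain ⟨t, ht⟩ := even_gramK3_diag i
    have hm : (Pi.single i m : K3Index → ℤ) = m • Pi.single i 1 := by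
      rw [← Pi.single_smul]; simp
    have h1 : formK3 (Pi.single i m) (Pi.single i m) = m * (m * gramK3 i i) := by
      rw [hm]
      simp only [map_smul, LinearMap.smul_apply, smul_eq_mul, formK3, Matrix.toBilin'_single]
    change ((formK3 (Pi.single i m) (Pi.single i m) : ℤ) : ZMod 2) = 0
    rw [h1, ht, ZMod.intCast_zmod_eq_zero_iff_dvd]
    exact ⟨m * (m * t), by push_cast; ring⟩
  have := congrArg (fun g => g x) hf
  exact (ZMod.intCast_eq_zero_iff_even).1 this

/-- The form of the K3-lattice modulo `2`. -/
noncomputable def formK3Mod2 : LinearMap.BilinForm (ZMod 2) (K3Index → ZMod 2) :=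
  Matrix.toBilin' (gramK3.map (Int.castRingHom (ZMod 2)))

/-- Reduction of the K3-lattice modulo `2`. -/
def redMod2 : (K3Index → ℤ) →+ (K3Index → ZMod 2) :=
  AddMonoidHom.compLeft (Int.castAddHom (ZMod 2)) K3Index

theorem formK3Mod2_nondegenerate : formK3Mod2.Nondegenerate := by
  refine LinearMap.BilinForm.nondegenerate_toBilin'_of_det_ne_zero' _ ?_
  have := isUnit_det_gramK3.map (Int.castRingHom (ZMod 2))
  rw [RingHom.map_det] at this
  exact this.ne_zero

theorem formK3Mod2_red (x y : K3Index → ℤ) :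
    formK3Mod2 (redMod2 x) (redMod2 y) = (formK3 x y : ZMod 2) := by
  simp [formK3Mod2, formK3, Matrix.toBilin'_apply, redMod2]

theorem redMod2_surjective : Function.Surjective redMod2 := fun y =>
  ⟨fun i => (y i).val, by ext i; simp [redMod2]⟩

theorem formK3Mod2_isRefl : formK3Mod2.IsRefl := by
  intro x y h
  obtain ⟨x, rfl⟩ := redMod2_surjective x
  obtain ⟨y, rfl⟩ := redMod2_surjective y
  rwa [formK3Mod2_red, formK3_comm, ← formK3Mod2_red]

theorem redMod2_eq_zero {x : K3Index → ℤ} (h : redMod2 x = 0) : ∃ z, x = (2 : ℤ) • z := by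
  have h' : ∀ i, ∃ t, x i = 2 * t := fun i =>
    (ZMod.intCast_zmod_eq_zero_iff_dvd (x i) 2).1 (congrFun h i)
  choose z hz using h'
  exact ⟨z, funext hz⟩

/-! ### Dimension count for a radical in a non-degenerate space. -/

/-- A totally isotropic image `T = P ∘ J` orthogonal to `range P` that contains the kernel of `P`:
comparing dimensions bounds the kernel of `T` from below, and in the case of equality
`range P` is the orthogonal complement of `range T`. -/
theorem range_eq_orthogonal_of_finrank_le {K V E R : Type*} [Field K]
    [AddCommGroup V] [Module K V] [FiniteDimensional K V]
    [AddCommGroup E] [Module K E] [FiniteDimensional K E]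
    [AddCommGroup R] [Module K R] [FiniteDimensional K R]
    (B : LinearMap.BilinForm K V) (hB : B.Nondegenerate) (hB' : B.IsRefl)
    (P : E →ₗ[K] V) (J : R →ₗ[K] E) (hJ : Function.Injective J)
    (hker : LinearMap.ker P ≤ LinearMap.range J) (horth : ∀ e r, B (P e) (P (J r)) = 0)
    (hle : finrank K V + 2 * finrank K (LinearMap.ker (P ∘ₗ J)) ≤ finrank K E + finrank K R) :
    finrank K V + 2 * finrank K (LinearMap.ker (P ∘ₗ J)) = finrank K E + finrank K R ∧
      ∀ v, (∀ r, B (P (J r)) v = 0) → v ∈ LinearMap.range P := by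
  have hk : finrank K (LinearMap.ker P) = finrank K (LinearMap.ker (P ∘ₗ J)) := by
    have h1 : LinearMap.ker P = (LinearMap.ker (P ∘ₗ J)).map J := by
      rw [LinearMap.ker_comp, Submodule.map_comap_eq, inf_eq_right.2 hker]
    rw [h1]
    exact (Submodule.equivMapOfInjective J hJ _).finrank_eq.symm
  have hsub : LinearMap.range (P ∘ₗ J) ≤ B.orthogonal (LinearMap.range P) := by
    rintro _ ⟨r, rfl⟩ _ ⟨e, rfl⟩
    exact horth e r
  have h1 := LinearMap.finrank_range_add_finrank_ker P
  have h2 := LinearMap.finrank_range_add_finrank_ker (P ∘ₗ J)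
  have h3 := LinearMap.BilinForm.finrank_orthogonal hB (LinearMap.range P)
  have h4 := Submodule.finrank_mono hsub
  have h5 := Submodule.finrank_le (LinearMap.range P)
  refine ⟨by omega, fun v hv => ?_⟩
  have h6 : LinearMap.range (P ∘ₗ J) = B.orthogonal (LinearMap.range P) :=
    Submodule.eq_of_le_of_finrank_eq hsub (by omega)
  rw [← LinearMap.BilinForm.orthogonal_orthogonal hB hB' (LinearMap.range P), ← h6]
  rintro _ ⟨r, rfl⟩
  exact hv r

/-! ### Parabolic configurations and their intersection numbers. -/

/-- Vectors of the K3-lattice with the intersection numbers of the graph `5Ã₃ + 2A₁` in degree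
`h²`: three consecutive vertices `a i j` of each `4`-cycle, the isolated vertices `v j`, and the
common class `k` of the `4`-cycles. -/
structure ParabolicConfiguration (d : ℤ) where
  a : Fin 5 → Fin 3 → K3Index → ℤ
  v : Fin 2 → K3Index → ℤ
  k : K3Index → ℤ
  h : K3Index → ℤ
  a_a : ∀ i j i' j', formK3 (a i j) (a i' j') =
    if i = i' then !![-2, 1, 0; 1, -2, 1; 0, 1, -2] j j' else 0
  a_v : ∀ i j j', formK3 (a i j) (v j') = 0
  v_v : ∀ j j', formK3 (v j) (v j') = if j = j' then -2 else 0
  k_a : ∀ i j, formK3 k (a i j) = 0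
  k_v : ∀ j, formK3 k (v j) = 0
  k_k : formK3 k k = 0
  a_h : ∀ i j, formK3 (a i j) h = d
  v_h : ∀ j, formK3 (v j) h = d
  k_h : formK3 k h = 4 * d

namespace ParabolicConfiguration

variable {d : ℤ} (X : ParabolicConfiguration d)

/-- The integral combination of the vectors of a configuration with given coefficients. -/
def vec (r : Fin 5 → Fin 3 → ℤ) (s : Fin 2 → ℤ) (c : ℤ) : K3Index → ℤ :=
  ∑ i, ∑ j, r i j • X.a i j + ∑ j, s j • X.v j + c • X.k

theorem vec_a (r : Fin 5 → Fin 3 → ℤ) (s : Fin 2 → ℤ) (c : ℤ) (i : Fin 5) (j : Fin 3) :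
    formK3 (X.vec r s c) (X.a i j) =
      ![-2 * r i 0 + r i 1, r i 0 - 2 * r i 1 + r i 2, r i 1 - 2 * r i 2] j := by
  have hva : ∀ j', formK3 (X.v j') (X.a i j) = 0 := fun j' => by rw [formK3_comm, X.a_v]
  simp only [vec, map_add, map_sum, map_smul, LinearMap.add_apply, LinearMap.sum_apply,
    LinearMap.smul_apply, X.a_a, hva, X.k_a, smul_eq_mul, mul_zero, Finset.sum_const_zero,
    add_zero]
  rw [Finset.sum_eq_single i (fun b _ hb => by simp [hb]) (by simp)]
  fin_cases j <;> simp [Fin.sum_univ_three] <;> ring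

theorem vec_v (r : Fin 5 → Fin 3 → ℤ) (s : Fin 2 → ℤ) (c : ℤ) (j : Fin 2) :
    formK3 (X.vec r s c) (X.v j) = -2 * s j := by
  simp only [vec, map_add, map_sum, map_smul, LinearMap.add_apply, LinearMap.sum_apply,
    LinearMap.smul_apply, X.a_v, X.v_v, X.k_v, smul_eq_mul]
  simp [mul_comm]

theorem vec_k (r : Fin 5 → Fin 3 → ℤ) (s : Fin 2 → ℤ) (c : ℤ) :
    formK3 (X.vec r s c) X.k = 0 := by
  rw [formK3_comm]
  simp only [vec, map_add, map_sum, map_smul, X.k_a, X.k_v, X.k_k, smul_zero,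
    Finset.sum_const_zero, add_zero]

theorem vec_h (r : Fin 5 → Fin 3 → ℤ) (s : Fin 2 → ℤ) (c : ℤ) :
    formK3 (X.vec r s c) X.h = d * (∑ i, (r i 0 + r i 1 + r i 2) + (s 0 + s 1) + 4 * c) := by
  simp only [vec, map_add, map_sum, map_smul, LinearMap.add_apply, LinearMap.sum_apply,
    LinearMap.smul_apply, X.a_h, X.v_h, X.k_h, smul_eq_mul, Fin.sum_univ_three, Fin.sum_univ_two,
    ← add_mul, ← Finset.sum_mul]
  ring

theorem vec_vec (r : Fin 5 → Fin 3 → ℤ) (s : Fin 2 → ℤ) (c : ℤ) :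
    formK3 (X.vec r s c) (X.vec r s c) =
      ∑ i, (-2 * (r i 0 ^ 2 + r i 1 ^ 2 + r i 2 ^ 2) + 2 * r i 1 * (r i 0 + r i 2)) +
        -2 * (s 0 ^ 2 + s 1 ^ 2) := by
  conv_lhs => rw [vec.eq_def X r s c]
  rw [formK3_comm, ← vec.eq_def X r s c]
  conv_lhs => arg 2; rw [vec]
  simp only [map_add, map_sum, map_smul, X.vec_a, X.vec_v, X.vec_k, smul_eq_mul,
    Fin.sum_univ_three, Fin.sum_univ_two, Matrix.cons_val]
  rw [mul_zero, add_zero]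
  congr 1
  · exact Finset.sum_congr rfl fun i _ => by ring
  · ring

/-! ### The configuration modulo 2 and its radical. -/

/-- Coefficient spaces modulo `2`. -/
abbrev CoeffMod2 : Type := (Fin 5 → Fin 3 → ZMod 2) × (Fin 2 → ZMod 2) × ZMod 2

/-- Coefficients modulo `2` of the elements of the radical. -/
abbrev RadMod2 : Type := (Fin 5 → ZMod 2) × (Fin 2 → ZMod 2) × ZMod 2

/-- Linear combinations modulo `2` of the vectors of a configuration. -/
def vecMod2 : CoeffMod2 →ₗ[ZMod 2] (K3Index → ZMod 2) where
  toFun p := ∑ i, ∑ j, p.1 i j • redMod2 (X.a i j) + ∑ j, p.2.1 j • redMod2 (X.v j) +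
    p.2.2 • redMod2 X.k
  map_add' p q := by
    simp only [Prod.fst_add, Prod.snd_add, Pi.add_apply, add_smul, Finset.sum_add_distrib]
    abel
  map_smul' c p := by
    simp only [Prod.smul_fst, Prod.smul_snd, Pi.smul_apply, smul_assoc, Finset.smul_sum, smul_add,
      RingHom.id_apply]

/-- The inclusion of the radical of the form modulo `2` of the configuration. -/
def radIncl : RadMod2 →ₗ[ZMod 2] CoeffMod2 where
  toFun p := (fun i => ![p.1 i, 0, p.1 i], p.2.1, p.2.2)
  map_add' p q := by
    ext i j <;> try rfl
    fin_cases j <;> simp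
  map_smul' c p := by
    ext i j <;> try rfl
    fin_cases j <;> simp

theorem radIncl_injective : Function.Injective radIncl := by
  intro p q hpq
  refine Prod.ext (funext fun i => ?_) (congrArg (fun t : CoeffMod2 => t.2) hpq)
  exact congrArg (fun t : CoeffMod2 => t.1 i 0) hpq

theorem redMod2_zsmul (n : ℤ) (x : K3Index → ℤ) : redMod2 (n • x) = (n : ZMod 2) • redMod2 x := by
  ext i; simp [redMod2]

theorem redMod2_vec (r : Fin 5 → Fin 3 → ℤ) (s : Fin 2 → ℤ) (c : ℤ) :
    redMod2 (X.vec r s c) = X.vecMod2 (fun i j => (r i j : ZMod 2), fun j => (s j : ZMod 2), c) := by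
  simp only [vec, map_add, map_sum, redMod2_zsmul]
  rfl

/-- Every combination modulo `2` lifts to an integral one, with coefficients `0` and `1`. -/
theorem vecMod2_eq (p : CoeffMod2) :
    X.vecMod2 p = redMod2 (X.vec (fun i j => (p.1 i j).val) (fun j => (p.2.1 j).val) p.2.2.val) := by
  rw [redMod2_vec]; simp

/-- A relation pairs to zero with every `a i j`, and the Gram matrix of `A₃` modulo 2 has kernel
spanned by `(1, 0, 1)`. -/
theorem ker_vecMod2_le : LinearMap.ker X.vecMod2 ≤ LinearMap.range radIncl := by
  intro p hp
  have key : ∀ i j, ![p.1 i 1, p.1 i 0 + p.1 i 2, p.1 i 1] j = 0 := by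
    intro i j
    have h1 : formK3Mod2 (X.vecMod2 p) (redMod2 (X.a i j)) = 0 := by
      rw [LinearMap.mem_ker.1 hp]; simp
    rw [vecMod2_eq, formK3Mod2_red, vec_a] at h1
    have h2 : (2 : ZMod 2) = 0 := by decide
    fin_cases j <;> simpa [h2] using h1
  refine ⟨(fun i => p.1 i 0, p.2.1, p.2.2), ?_⟩
  refine Prod.ext (funext fun i => funext fun j => ?_) rfl
  have h0 : p.1 i 1 = 0 := key i 0
  have h1 : p.1 i 0 + p.1 i 2 = 0 := key i 1
  have h2 : p.1 i 0 = p.1 i 2 := CharTwo.add_eq_zero.1 h1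
  fin_cases j
  · rfl
  · exact h0.symm
  · exact h2

theorem vecMod2_radIncl_orthogonal (e : CoeffMod2) (c : RadMod2) :
    formK3Mod2 (X.vecMod2 e) (X.vecMod2 (radIncl c)) = 0 := by
  have hsum : ∀ x : K3Index → ZMod 2, (∀ i, formK3Mod2 x (redMod2 (X.a i 0)) =
      formK3Mod2 x (redMod2 (X.a i 2))) → (∀ j, formK3Mod2 x (redMod2 (X.v j)) = 0) →
      formK3Mod2 x (redMod2 X.k) = 0 → formK3Mod2 x (X.vecMod2 (radIncl c)) = 0 := by
    intro x h1 h2 h3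
    simp only [vecMod2, radIncl, LinearMap.coe_mk, AddHom.coe_mk, map_add, map_sum, map_smul, h2,
      h3, Fin.sum_univ_three, Matrix.cons_val, h1, smul_zero, Finset.sum_const_zero, zero_smul,
      add_zero]
    exact Finset.sum_eq_zero fun i _ => CharTwo.add_self_eq_zero _
  have h2 : (2 : ZMod 2) = 0 := by decide
  rw [vecMod2_eq]
  refine hsum _ (fun i => ?_) (fun j => ?_) ?_
  · simp [formK3Mod2_red, vec_a, h2]
  · simp [formK3Mod2_red, vec_v, h2]
  · simp [formK3Mod2_red, vec_k]

/-! ### The binary code of half-integral vectors. -/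

/-- There are no exceptional divisors: no vector with half-integral coefficients is a
`(-2)`-vector orthogonal to `h`. -/
def NoExceptional : Prop :=
  ∀ x r s c, X.vec r s c = (2 : ℤ) • x → ¬ (formK3 x x = -2 ∧ formK3 x X.h = 0)

/-- The kernel of the map from the radical modulo `2` to the K3-lattice modulo `2`. -/
def halfKernel : Submodule (ZMod 2) RadMod2 := LinearMap.ker (X.vecMod2 ∘ₗ radIncl)

/-- The number of nonzero coefficients at the `4`-cycles. -/
def cycleWeight (u : Fin 5 → ZMod 2) : ℕ := ∑ i, (u i).val

/-- Each word misses one of the five cycles, so the sum is supported on the two missed ones. -/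
theorem cycleWeight_add_of_four : ∀ u u' : Fin 5 → ZMod 2, cycleWeight u = 4 →
    cycleWeight u' = 4 → cycleWeight (u + u') = 2 ∨ u = u' := by
  unfold cycleWeight
  decide +kernel

theorem cycleWeight_add_of_five : ∀ u u' : Fin 5 → ZMod 2, cycleWeight u = 5 →
    cycleWeight u' = 4 → cycleWeight (u + u') = 1 := by
  unfold cycleWeight
  decide +kernel

theorem cycleWeight_eq_zero : ∀ u : Fin 5 → ZMod 2, cycleWeight u = 0 → u = 0 := by
  unfold cycleWeight
  decide +kernel

theorem cycleWeight_le : ∀ u : Fin 5 → ZMod 2, cycleWeight u ≤ 5 := by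
  unfold cycleWeight
  decide +kernel

theorem val_eq_zero_or_one (x : ZMod 2) : x.val = 0 ∨ x.val = 1 := by
  have := ZMod.val_lt x
  omega

variable {X}

/-- Every integral lift of a word is divisible by 2; the freedom in choosing signs and the multiple
of `k` serves to adjust the degree. -/
theorem exists_half {c : RadMod2} (hc : c ∈ X.halfKernel) (r : Fin 5 → Fin 3 → ℤ) (s : Fin 2 → ℤ)
    (t : ℤ) (hr : ∀ i, (r i 0 : ZMod 2) = c.1 i ∧ (r i 1 : ZMod 2) = 0 ∧ (r i 2 : ZMod 2) = c.1 i)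
    (hs : ∀ j, (s j : ZMod 2) = c.2.1 j) (ht : (t : ZMod 2) = c.2.2) :
    ∃ x, X.vec r s t = (2 : ℤ) • x := by
  apply redMod2_eq_zero
  rw [redMod2_vec]
  have h1 : X.vecMod2 (radIncl c) = 0 := hc
  rw [← h1]
  congr 1
  refine Prod.ext (funext fun i => funext fun j => ?_) (Prod.ext (funext hs) ht)
  fin_cases j
  · exact (hr i).1
  · exact (hr i).2.1
  · exact (hr i).2.2

/-- The half-integral vector with coefficients in `{0, 1/2}`. -/
theorem exists_standard_half {c : RadMod2} (hc : c ∈ X.halfKernel) :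
    ∃ x, X.vec (fun i => ![(c.1 i).val, 0, (c.1 i).val]) (fun j => (c.2.1 j).val) c.2.2.val =
      (2 : ℤ) • x :=
  exists_half hc _ _ _ (fun i => by simp) (fun j => by simp) (by simp)

/-- The standard half has square minus half the weight, and this must be even. -/
theorem four_dvd_weight {c : RadMod2} (hc : c ∈ X.halfKernel) :
    4 ∣ 2 * cycleWeight c.1 + ((c.2.1 0).val + (c.2.1 1).val) := by
  obtain ⟨x, hx⟩ := exists_standard_half hc
  have h1 := X.vec_vec (fun i => ![(c.1 i).val, 0, (c.1 i).val]) (fun j => (c.2.1 j).val) c.2.2.val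
  have h2 : ∑ i, (-2 * (((c.1 i).val : ℤ) ^ 2 + 0 ^ 2 + ((c.1 i).val : ℤ) ^ 2) +
      2 * 0 * (((c.1 i).val : ℤ) + (c.1 i).val)) = -4 * (cycleWeight c.1 : ℤ) := by
    rw [cycleWeight, Nat.cast_sum, Finset.mul_sum]
    refine Finset.sum_congr rfl fun i _ => ?_
    rcases val_eq_zero_or_one (c.1 i) with h | h <;> simp [h]
  simp only [Matrix.cons_val] at h1
  rw [h2, hx] at h1
  simp only [map_smul, LinearMap.smul_apply, smul_eq_mul] at h1
  obtain ⟨t, ht⟩ := even_formK3 x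
  rw [ht] at h1
  rcases val_eq_zero_or_one (c.2.1 0) with h | h <;>
    rcases val_eq_zero_or_one (c.2.1 1) with h' | h' <;> rw [h, h'] at h1 ⊢ <;>
    norm_num at h1 <;> omega

theorem not_exceptional (hX : X.NoExceptional) {r : Fin 5 → Fin 3 → ℤ} {s : Fin 2 → ℤ} {t : ℤ}
    (hx : ∃ x, X.vec r s t = (2 : ℤ) • x)
    (h1 : ∑ i, (-2 * (r i 0 ^ 2 + r i 1 ^ 2 + r i 2 ^ 2) + 2 * r i 1 * (r i 0 + r i 2)) +
        -2 * (s 0 ^ 2 + s 1 ^ 2) = -8)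
    (h2 : ∑ i, (r i 0 + r i 1 + r i 2) + (s 0 + s 1) + 4 * t = 0) : False := by
  obtain ⟨x, hx⟩ := hx
  have h3 := X.vec_vec r s t
  have h4 := X.vec_h r s t
  rw [h1, hx] at h3
  rw [h2, hx] at h4
  simp only [map_smul, LinearMap.smul_apply, smul_eq_mul] at h3 h4
  exact hX x r s t hx ⟨by linarith, by linarith⟩

/-- Such a half would be a `(-2)`-vector. Its degree is made zero by opposite signs if the
coefficient of `k` is even, and by subtracting `k/2` if it is odd. -/
theorem weight_ne_four (hX : X.NoExceptional) {c : RadMod2} (hc : c ∈ X.halfKernel) :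
    2 * cycleWeight c.1 + ((c.2.1 0).val + (c.2.1 1).val) ≠ 4 := by
  intro hw
  have hs : (c.2.1 0).val = (c.2.1 1).val := by
    rcases val_eq_zero_or_one (c.2.1 0) with h | h <;>
      rcases val_eq_zero_or_one (c.2.1 1) with h' | h' <;> omega
  have hw' : 2 * (cycleWeight c.1 : ℤ) + 2 * ((c.2.1 1).val : ℤ) = 4 := by
    rw [hs] at hw
    zify at hw
    linarith
  have hsq : ∀ x : ZMod 2, (x.val : ℤ) ^ 2 = x.val := fun x => by
    rcases val_eq_zero_or_one x with h | h <;> simp [h]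
  have hcw : (cycleWeight c.1 : ℤ) = ∑ i, ((c.1 i).val : ℤ) := by
    rw [cycleWeight, Nat.cast_sum]
  rcases val_eq_zero_or_one c.2.2 with h | h
  · have h0 : c.2.2 = 0 := (ZMod.val_eq_zero _).1 h
    refine not_exceptional hX (exists_half hc (fun i => ![(c.1 i).val, 0, -(c.1 i).val])
      ![(c.2.1 0).val, -(c.2.1 1).val] 0 (fun i => by simp) (fun j => ?_) (by simp [h0])) ?_ ?_
    · fin_cases j <;> simp
    · simp [-ZMod.natCast_val, hsq, hs, ← two_mul, ← mul_assoc, ← Finset.mul_sum, ← hcw]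
      linarith
    · simp [hs]
  · have h0 : c.2.2 = 1 := by
      rw [← ZMod.natCast_zmod_val c.2.2, h]; rfl
    refine not_exceptional hX (exists_half hc (fun i => ![(c.1 i).val, 0, (c.1 i).val])
      (fun j => (c.2.1 j).val) (-1) (fun i => by simp) (fun j => by simp) (by simp [h0])) ?_ ?_
    · simp [-ZMod.natCast_val, hsq, hs, ← two_mul, ← mul_assoc, ← Finset.mul_sum, ← hcw]
      linarith
    · simp [-ZMod.natCast_val, hs, ← two_mul, ← Finset.mul_sum, ← hcw]
      linarith

theorem weight_ne_zero (hX : X.NoExceptional) {c : RadMod2} (hc : c ∈ X.halfKernel) (hc0 : c ≠ 0) :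
    2 * cycleWeight c.1 + ((c.2.1 0).val + (c.2.1 1).val) ≠ 0 := by
  intro hw
  have h1 : c.1 = 0 := cycleWeight_eq_zero _ (by omega)
  have h2 : c.2.1 = 0 := by
    funext j
    have e0 : (c.2.1 0).val = 0 := by omega
    have e1 : (c.2.1 1).val = 0 := by omega
    fin_cases j
    · exact (ZMod.val_eq_zero _).1 e0
    · exact (ZMod.val_eq_zero _).1 e1
  rcases val_eq_zero_or_one c.2.2 with h | h
  · exact hc0 (Prod.ext h1 (Prod.ext h2 ((ZMod.val_eq_zero _).1 h)))
  · have h0 : c.2.2 = 1 := by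
      rw [← ZMod.natCast_zmod_val c.2.2, h]; rfl
    -- If `k/2` is integral, then `a 0 0 + a 0 1 - k/2` has square `-2` and degree `2d - 2d = 0`.
    refine not_exceptional hX (exists_half hc (fun i => if i = 0 then ![2, 2, 0] else 0)
      0 (-1) (fun i => ?_) (fun j => by simp [h2]) (by simp [h0])) ?_ ?_
    · have : (2 : ZMod 2) = 0 := by decide
      by_cases hi : i = 0 <;> simp [h1, hi, this]
    · simp [Fin.sum_univ_five]
    · simp [Fin.sum_univ_five]

/-- The weight is a multiple of 4, at most 12, and neither 0 nor 4. -/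
theorem weight_of_ne_zero (hX : X.NoExceptional) {c : RadMod2} (hc : c ∈ X.halfKernel)
    (hc0 : c ≠ 0) : ((c.2.1 0 = 0 ∧ c.2.1 1 = 0) ∧ cycleWeight c.1 = 4) ∨
      ((c.2.1 0 = 1 ∧ c.2.1 1 = 1) ∧ (cycleWeight c.1 = 3 ∨ cycleWeight c.1 = 5)) := by
  have h1 := four_dvd_weight hc
  have h2 := weight_ne_four hX hc
  have h3 := weight_ne_zero hX hc hc0
  have h4 := cycleWeight_le c.1
  have hv : ∀ x : ZMod 2, (x = 0 ∧ x.val = 0) ∨ (x = 1 ∧ x.val = 1) := by decide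
  rcases hv (c.2.1 0) with ⟨e, h⟩ | ⟨e, h⟩ <;> rcases hv (c.2.1 1) with ⟨e', h'⟩ | ⟨e', h'⟩ <;>
    rw [h, h'] at h1 h2 h3 <;> rw [e, e'] <;> simp <;> omega

/-- The coefficient at the first isolated vertex, on `halfKernel`. -/
def isolatedCoeff (X : ParabolicConfiguration d) : X.halfKernel →ₗ[ZMod 2] ZMod 2 :=
  (LinearMap.proj 0 ∘ₗ LinearMap.fst _ _ _ ∘ₗ LinearMap.snd _ _ _) ∘ₗ X.halfKernel.subtype

theorem cycleWeight_of_isolatedCoeff_eq_zero (hX : X.NoExceptional) {c : X.halfKernel}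
    (hc : isolatedCoeff X c = 0) (hc0 : c ≠ 0) : cycleWeight c.1.1 = 4 := by
  have hc' : c.1.2.1 0 = 0 := hc
  rcases weight_of_ne_zero hX c.2 (fun h => hc0 (Subtype.ext h)) with h | h
  · exact h.2
  · rw [hc'] at h
    exact absurd h.1.1 (by decide)

/-- If distinct, their sum would again meet four cycles, but the sum of two such words meets two or
none. -/
theorem eq_of_isolatedCoeff_eq_zero (hX : X.NoExceptional) {c c' : X.halfKernel}
    (hc : isolatedCoeff X c = 0) (hc' : isolatedCoeff X c' = 0) (hc0 : c ≠ 0) (hc0' : c' ≠ 0) :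
    c = c' := by
  by_contra hne
  have h0 : c + c' ≠ 0 := fun h => hne (by
    rw [← sub_eq_zero, ← h, sub_eq_add_neg]
    congr 1
    exact Subtype.ext (by ext <;> simp [ZMod.neg_eq_self_mod_two]))
  have h1 := cycleWeight_of_isolatedCoeff_eq_zero hX hc hc0
  have h2 := cycleWeight_of_isolatedCoeff_eq_zero hX hc' hc0'
  have h3 := cycleWeight_of_isolatedCoeff_eq_zero hX (c := c + c') (by simp [hc, hc']) h0
  rcases cycleWeight_add_of_four _ _ h1 h2 with h | h
  · exact absurd (h.symm.trans h3) (by norm_num)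
  · have h4 : (c + c').1.1 = 0 := by
      change c.1.1 + c'.1.1 = 0
      rw [h]
      ext i
      exact CharTwo.add_self_eq_zero _
    rw [h4] at h3
    exact absurd h3 (by unfold cycleWeight; decide)

theorem finrank_ker_isolatedCoeff_le (hX : X.NoExceptional) :
    finrank (ZMod 2) (LinearMap.ker (isolatedCoeff X)) ≤ 1 := by
  by_cases h : ∃ c : LinearMap.ker (isolatedCoeff X), c ≠ 0
  · obtain ⟨c, hc⟩ := h
    refine finrank_le_one c fun w => ?_
    by_cases hw : w = 0
    · exact ⟨0, by rw [hw, zero_smul]⟩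
    · refine ⟨1, ?_⟩
      rw [one_smul]
      exact Subtype.ext (eq_of_isolatedCoeff_eq_zero hX c.2 w.2 (fun h => hc (Subtype.ext h))
        (fun h => hw (Subtype.ext h)))
  · push Not at h
    exact finrank_le_one 0 fun w => ⟨0, by rw [h w, zero_smul]⟩

theorem finrank_range_isolatedCoeff_le :
    finrank (ZMod 2) (LinearMap.range (isolatedCoeff X)) ≤ 1 := by
  simpa using Submodule.finrank_le (LinearMap.range (isolatedCoeff X))

theorem finrank_halfKernel_le (hX : X.NoExceptional) : finrank (ZMod 2) X.halfKernel ≤ 2 := by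
  have h1 := LinearMap.finrank_range_add_finrank_ker (isolatedCoeff X)
  have h2 := finrank_ker_isolatedCoeff_le hX
  have h3 := finrank_range_isolatedCoeff_le (X := X)
  omega

theorem exists_weight_three (hX : X.NoExceptional) (h : finrank (ZMod 2) X.halfKernel = 2) :
    ∃ c ∈ X.halfKernel, cycleWeight c.1 = 3 ∧ c.2.1 0 = 1 ∧ c.2.1 1 = 1 := by
  have h1 := LinearMap.finrank_range_add_finrank_ker (isolatedCoeff X)
  have h2 := finrank_ker_isolatedCoeff_le hX
  have h3 := finrank_range_isolatedCoeff_le (X := X)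
  have hr : 0 < finrank (ZMod 2) (LinearMap.range (isolatedCoeff X)) := by omega
  have hk : 0 < finrank (ZMod 2) (LinearMap.ker (isolatedCoeff X)) := by omega
  obtain ⟨⟨_, c, rfl⟩, hc⟩ := finrank_pos_iff_exists_ne_zero.1 hr
  obtain ⟨c', hc'⟩ := finrank_pos_iff_exists_ne_zero.1 hk
  have hc1 : isolatedCoeff X c ≠ 0 := fun h => hc (Subtype.ext h)
  have hc0 : (c : RadMod2) ≠ 0 := fun h => hc1 (by
    rw [show c = 0 from Subtype.ext h, map_zero])
  have hc0' : (c' : X.halfKernel) ≠ 0 := fun h => hc' (Subtype.ext h)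
  have hw' := cycleWeight_of_isolatedCoeff_eq_zero hX c'.2 hc0'
  rcases weight_of_ne_zero hX c.2 hc0 with hw | ⟨hs, hw | hw⟩
  · exact absurd hw.1.1 hc1
  · exact ⟨c, c.2, hw, hs⟩
  -- A word on all five cycles, added to one on four, would meet a single cycle.
  · exfalso
    have hs1 : isolatedCoeff X (c + c') = 1 := by
      rw [map_add, LinearMap.mem_ker.1 c'.2, add_zero]
      exact hs.1
    have h5 := cycleWeight_add_of_five _ _ hw hw'
    have h6 : ((c + c' : X.halfKernel) : RadMod2) ≠ 0 := fun h => by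
      rw [show c + (c' : X.halfKernel) = 0 from Subtype.ext h, map_zero] at hs1
      exact absurd hs1 (by decide)
    have h7 : cycleWeight ((c + c' : X.halfKernel) : RadMod2).1 = 1 := h5
    rcases weight_of_ne_zero hX (c + (c' : X.halfKernel)).2 h6 with h | h <;> omega

/-! ### Equality in the dimension count. -/

variable (X)

theorem finrank_k3Mod2 : finrank (ZMod 2) (K3Index → ZMod 2) = 22 := by
  rw [finrank_pi]; rfl

theorem finrank_coeffMod2 : finrank (ZMod 2) CoeffMod2 = 18 := by
  simp [finrank_prod, finrank_pi_fintype]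

theorem finrank_radMod2 : finrank (ZMod 2) RadMod2 = 8 := by
  simp [finrank_prod]

/-- Numerically `22 + 2 · 2 = 18 + 8`: the upper bound 2 for the code is exactly the lower bound
from duality. -/
theorem finrank_bound (hX : X.NoExceptional) :
    finrank (ZMod 2) (K3Index → ZMod 2) +
        2 * finrank (ZMod 2) (LinearMap.ker (X.vecMod2 ∘ₗ radIncl)) ≤
      finrank (ZMod 2) CoeffMod2 + finrank (ZMod 2) RadMod2 := by
  have h := finrank_halfKernel_le hX
  rw [halfKernel] at h
  rw [finrank_k3Mod2, finrank_coeffMod2, finrank_radMod2]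
  omega

theorem finrank_halfKernel (hX : X.NoExceptional) : finrank (ZMod 2) X.halfKernel = 2 := by
  have h := (range_eq_orthogonal_of_finrank_le formK3Mod2 formK3Mod2_nondegenerate
    formK3Mod2_isRefl X.vecMod2 radIncl radIncl_injective X.ker_vecMod2_le
    X.vecMod2_radIncl_orthogonal (X.finrank_bound hX)).1
  rw [← halfKernel] at h
  rw [finrank_k3Mod2, finrank_coeffMod2, finrank_radMod2] at h
  omega

/-- A vector of the K3-lattice which has even intersection with the radical of the configuration
modulo `2` is congruent modulo `2` to a combination of the vectors of the configuration. -/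
theorem exists_eq_vec_add (hX : X.NoExceptional) (y : K3Index → ℤ)
    (ha : ∀ i, Even (formK3 (X.a i 0 + X.a i 2) y)) (hv : ∀ j, Even (formK3 (X.v j) y))
    (hk : Even (formK3 X.k y)) : ∃ r s c z, y = X.vec r s c + (2 : ℤ) • z := by
  have hy : redMod2 y ∈ LinearMap.range X.vecMod2 := by
    refine (range_eq_orthogonal_of_finrank_le formK3Mod2 formK3Mod2_nondegenerate
      formK3Mod2_isRefl X.vecMod2 radIncl radIncl_injective X.ker_vecMod2_le
      X.vecMod2_radIncl_orthogonal (X.finrank_bound hX)).2 _ fun c => ?_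
    have ha' : ∀ i, formK3Mod2 (redMod2 (X.a i 0)) (redMod2 y) +
        formK3Mod2 (redMod2 (X.a i 2)) (redMod2 y) = 0 := fun i => by
      rw [formK3Mod2_red, formK3Mod2_red, ← Int.cast_add, ZMod.intCast_eq_zero_iff_even]
      simpa using ha i
    have hv' : ∀ j, formK3Mod2 (redMod2 (X.v j)) (redMod2 y) = 0 := fun j => by
      rw [formK3Mod2_red, ZMod.intCast_eq_zero_iff_even]
      exact hv j
    have hk' : formK3Mod2 (redMod2 X.k) (redMod2 y) = 0 := by
      rw [formK3Mod2_red, ZMod.intCast_eq_zero_iff_even]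
      exact hk
    simp only [vecMod2, radIncl, LinearMap.coe_mk, AddHom.coe_mk, map_add, map_sum, map_smul,
      LinearMap.add_apply, LinearMap.sum_apply, LinearMap.smul_apply, hv', hk',
      Fin.sum_univ_three, Matrix.cons_val, smul_zero, Finset.sum_const_zero, zero_smul, add_zero,
      ← smul_add, ha']
  obtain ⟨p, hp⟩ := hy
  rw [vecMod2_eq] at hp
  obtain ⟨z, hz⟩ := redMod2_eq_zero (x := y - X.vec _ _ _) (by rw [map_sub, ← hp, sub_self])
  exact ⟨_, _, _, z, by rw [← hz]; abel⟩

/-! ### The degree modulo 4. -/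

/-- The contribution of a `4`-cycle to the square of twice the polarization. -/
theorem sixteen_dvd_cycle (x y z : ℤ) (c : ℤ) (hc : c = 0 ∨ c = 1)
    (h1 : (4 : ℤ) ∣ -2 * (2 * x + c) + 2 * y - 2)
    (h2 : (4 : ℤ) ∣ (2 * x + c) - 2 * (2 * y) + (2 * z + c) - 2) :
    (16 : ℤ) ∣ -2 * ((2 * x + c) ^ 2 + (2 * y) ^ 2 + (2 * z + c) ^ 2) +
      2 * (2 * y) * ((2 * x + c) + (2 * z + c)) - (8 + 4 * c) := by
  obtain ⟨u, hu⟩ := h1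
  obtain ⟨w, hw⟩ := h2
  -- The congruences fix the parities of `y` and `x + z`: both odd for `c = 0`, both even for `c =
  -- 1`.
  rcases hc with rfl | rfl
  · obtain ⟨q, rfl⟩ : ∃ q, y = 2 * q + 1 := ⟨u + x, by linarith⟩
    obtain ⟨p, rfl⟩ : ∃ p, z = 2 * p + 1 - x := ⟨w + (2 * q + 1), by linarith⟩
    exact ⟨-2 * p ^ 2 - p - 2 * q ^ 2 - q - 1 + x * (2 * p + 1 - x) + 2 * p * q, by ring⟩
  · obtain ⟨q, rfl⟩ : ∃ q, y = 2 * q := ⟨1 + u + x, by linarith⟩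
    obtain ⟨p, rfl⟩ : ∃ p, z = 2 * p - x := ⟨w + 2 * q, by linarith⟩
    exact ⟨-(2 * p ^ 2 + p - x * (2 * p - x)) - 1 - 2 * q ^ 2 + q * (2 * p + 1), by ring⟩

/-- The square of the polarization is divisible by `4`. -/
theorem four_dvd_degree (hX : X.NoExceptional) (hd : Odd d) : (4 : ℤ) ∣ formK3 X.h X.h := by
  obtain ⟨c, hc, hw, hs0, hs1⟩ := exists_weight_three hX (X.finrank_halfKernel hX)
  obtain ⟨x, hx⟩ := exists_standard_half hc
  obtain ⟨δ, hδ⟩ := hd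
  have hs : ∀ j, c.2.1 j = 1 := fun j => by fin_cases j <;> assumption
  have pair : ∀ y, 2 * formK3 y x = formK3 (X.vec (fun i => ![(c.1 i).val, 0, (c.1 i).val])
      (fun j => (c.2.1 j).val) c.2.2.val) y := fun y => by
    rw [hx, formK3_comm y, map_smul, LinearMap.smul_apply, smul_eq_mul]
  -- Here `h` alone fails: `v j · h = d` is odd. Subtracting `x` corrects this, since `v j · x =
  -- -1`.
  obtain ⟨r, s, t, z, hz⟩ := X.exists_eq_vec_add hX (X.h - x) (fun i => by
      have h0 := pair (X.a i 0)
      have h2 := pair (X.a i 2)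
      rw [vec_a] at h0 h2
      simp only [Matrix.cons_val] at h0 h2
      simp only [map_add, map_sub, LinearMap.add_apply, X.a_h]
      exact ⟨d + (c.1 i).val, by linarith⟩) (fun j => by
      have h0 := pair (X.v j)
      rw [vec_v, hs] at h0
      rw [map_sub, X.v_h]
      refine ⟨δ + 1, ?_⟩
      have : (((1 : ZMod 2).val : ℕ) : ℤ) = 1 := rfl
      rw [this] at h0
      linarith) (by
      have h0 := pair X.k
      rw [vec_k] at h0
      rw [map_sub, X.k_h]
      exact ⟨2 * d, by linarith⟩)
  set ε : Fin 5 → ℤ := fun i => ((c.1 i).val : ℤ) with hε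
  set Y := X.vec (fun i => ![2 * r i 0 + ε i, 2 * r i 1, 2 * r i 2 + ε i])
    (fun j => 2 * s j + 1) (2 * t + c.2.2.val) with hY
  have hYx : Y = (2 : ℤ) • (X.vec r s t + x) := by
    rw [smul_add, ← hx, hY]
    simp only [vec, hs]
    have : (((1 : ZMod 2).val : ℕ) : ℤ) = 1 := rfl
    simp only [this, Fin.sum_univ_three, Matrix.cons_val, Finset.smul_sum, smul_add, add_smul,
      Finset.sum_add_distrib, mul_smul, zero_smul]
    abel
  have h2h : (2 : ℤ) • X.h = Y + (4 : ℤ) • z := by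
    have : X.h = X.vec r s t + x + (2 : ℤ) • z := by
      rw [add_right_comm, ← hz]; abel
    rw [hYx, this]
    module
  -- `2h · a i j = 2d` is 2 modulo 4 because `d` is odd.
  have hYa : ∀ i j, (4 : ℤ) ∣ formK3 Y (X.a i j) - 2 := fun i j => by
    have h1 : 2 * formK3 X.h (X.a i j) = formK3 Y (X.a i j) + 4 * formK3 z (X.a i j) := by
      simpa only [map_add, map_smul, LinearMap.add_apply, LinearMap.smul_apply, smul_eq_mul]
        using congrArg (fun y => formK3 y (X.a i j)) h2h
    rw [formK3_comm X.h, X.a_h] at h1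
    exact ⟨δ - formK3 z (X.a i j), by linarith⟩
  have hQ : ∀ i, ∃ q, -2 * ((2 * r i 0 + ε i) ^ 2 + (2 * r i 1) ^ 2 + (2 * r i 2 + ε i) ^ 2) +
      2 * (2 * r i 1) * ((2 * r i 0 + ε i) + (2 * r i 2 + ε i)) = 8 + 4 * ε i + 16 * q := by
    intro i
    have h0 := hYa i 0
    have h1 := hYa i 1
    rw [hY, vec_a] at h0 h1
    obtain ⟨q, hq⟩ := sixteen_dvd_cycle (r i 0) (r i 1) (r i 2) (ε i)
      (by rcases val_eq_zero_or_one (c.1 i) with h | h <;> simp [hε, -ZMod.natCast_val, h]) h0 h1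
    exact ⟨q, by linarith⟩
  choose q hq using hQ
  have hYY : (16 : ℤ) ∣ formK3 Y Y := by
    rw [hY, vec_vec]
    simp only [Matrix.cons_val, hq, Finset.sum_add_distrib, ← Finset.mul_sum]
    have h3 : ∑ i, ε i = 3 := by
      rw [hε, ← Nat.cast_sum]
      exact_mod_cast hw
    rw [h3]
    obtain ⟨m, hm⟩ := Int.even_mul_succ_self (s 0)
    obtain ⟨m', hm'⟩ := Int.even_mul_succ_self (s 1)
    -- The constant is `5 · 8 + 4 · 3 - 4 = 48 = 16 · 3`, where `-4` comes from the two odd squares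
    -- at the isolated vertices.
    refine ⟨3 + ∑ i, q i - m - m', ?_⟩
    simp
    linear_combination -8 * hm - 8 * hm'
  have hYz : formK3 Y z = 2 * formK3 (X.vec r s t + x) z := by
    rw [hYx, map_smul, LinearMap.smul_apply, smul_eq_mul]
  have hhh : 4 * formK3 X.h X.h = formK3 Y Y + 8 * formK3 Y z + 16 * formK3 z z := by
    have h1 := congrArg (fun y => formK3 y y) h2h
    simp only [map_add, map_smul, LinearMap.add_apply, LinearMap.smul_apply, smul_eq_mul,
      formK3_comm z Y] at h1
    linarith
  obtain ⟨m, hm⟩ := hYY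
  exact ⟨m + formK3 (X.vec r s t + x) z + formK3 z z, by linarith⟩

end ParabolicConfiguration

/-! ### From the graph to a parabolic configuration. -/

theorem Multigraph.fanoForm_gen {V : Type*} [DecidableEq V] [Fintype V] (G : Multigraph V)
    (D d : ℤ) (i j : Option V) :
    G.fanoForm D d (G.fanoGen D d i) (G.fanoGen D d j) = G.gram D d i j := by
  change G.preForm D d (Pi.single i 1) (Pi.single j 1) = _
  rw [Multigraph.preForm, Matrix.toBilin'_single]

theorem graph5A3plus2A1_gram_cycle : ∀ (i : Fin 5) (j : Fin 4) (i' : Fin 5) (j' : Fin 4),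
    (if (Sum.inl (i, j) : (Fin 5 × Fin 4) ⊕ (Fin 2 × Fin 1)) = Sum.inl (i', j') then (-2 : ℤ)
      else (graph5A3plus2A1.mult (Sum.inl (i, j)) (Sum.inl (i', j')) : ℤ)) =
    if i = i' then !![-2, 1, 0, 1; 1, -2, 1, 0; 0, 1, -2, 1; 1, 0, 1, -2] j j' else 0 := by
  decide +kernel

theorem graph5A3plus2A1_gram_isolated : ∀ (j j' : Fin 2),
    (if (Sum.inr (j, 0) : (Fin 5 × Fin 4) ⊕ (Fin 2 × Fin 1)) = Sum.inr (j', 0) then (-2 : ℤ)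
      else (graph5A3plus2A1.mult (Sum.inr (j, 0)) (Sum.inr (j', 0)) : ℤ)) =
    if j = j' then -2 else 0 := by
  decide +kernel

/-- Vectors of the K3-lattice with the Gram matrix of the graph contain a parabolic
configuration. -/
noncomputable def ParabolicConfiguration.ofGram {D d : ℤ}
    (g : Option ((Fin 5 × Fin 4) ⊕ (Fin 2 × Fin 1)) → K3Index → ℤ)
    (hg : ∀ i j, formK3 (g i) (g j) = graph5A3plus2A1.gram D d i j) :
    ParabolicConfiguration d :=
  have hc : ∀ i j i' j', formK3 (g (some (.inl (i, j)))) (g (some (.inl (i', j')))) =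
      if i = i' then !![-2, 1, 0, 1; 1, -2, 1, 0; 0, 1, -2, 1; 1, 0, 1, -2] j j' else 0 :=
    fun i j i' j' => (hg _ _).trans (graph5A3plus2A1_gram_cycle i j i' j')
  have hcv : ∀ i j j', formK3 (g (some (.inl (i, j)))) (g (some (.inr (j', 0)))) = 0 :=
    fun i j j' => (hg _ _).trans (by simp [Multigraph.gram, graph5A3plus2A1, Multigraph.sum])
  { a := fun i j => g (some (.inl (i, j.castSucc)))
    v := fun j => g (some (.inr (j, 0)))
    -- All five cycle sums have the same products with the generators, so any one of them serves.
    k := ∑ j, g (some (.inl (0, j)))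
    h := g none
    a_a := fun i j i' j' => by
      rw [hc]
      congr 1
      fin_cases j <;> fin_cases j' <;> rfl
    a_v := fun i j j' => hcv i _ j'
    v_v := fun j j' => (hg _ _).trans (graph5A3plus2A1_gram_isolated j j')
    k_a := fun i j => by
      simp only [map_sum, LinearMap.sum_apply, hc]
      by_cases hi : 0 = i
      · fin_cases j <;> simp [hi, Fin.sum_univ_four]
      · simp [hi]
    k_v := fun j => by
      simp only [map_sum, LinearMap.sum_apply, hcv, Finset.sum_const_zero]
    k_k := by
      simp only [map_sum, LinearMap.sum_apply, hc]
      simp [Fin.sum_univ_four]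
    a_h := fun i j => hg _ _
    v_h := fun j => hg _ _
    k_h := by
      have h1 : ∀ j, formK3 (g (some (.inl (0, j)))) (g none) = d := fun j => hg _ _
      simp only [map_sum, LinearMap.sum_apply, h1]
      simp }

theorem graph5A3plus2A1_not_subgeometric {d n : ℤ} (hd : Odd d) (hn : Odd n) :
    ¬ graph5A3plus2A1.Subgeometric (2 * n) d := by
  rintro ⟨-, S, _, B, ι, -, hι, -, -, -, ⟨hadm, φ, -, hφ, hprim⟩, -⟩
  let g := fun i => φ (ι (graph5A3plus2A1.fanoGen (2 * n) d i))
  have hg : ∀ i j, formK3 (g i) (g j) = graph5A3plus2A1.gram (2 * n) d i j := fun i j => by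
    rw [hφ, hι, Multigraph.fanoForm_gen]
  let X := ParabolicConfiguration.ofGram g hg
  have hmem : ∀ i, g i ∈ LinearMap.range φ := fun i => ⟨_, rfl⟩
  have hk : X.k ∈ LinearMap.range φ := by
    change ∑ j, g (some (.inl (0, j))) ∈ LinearMap.range φ
    exact sum_mem fun j _ => hmem _
  have hX : X.NoExceptional := by
    intro x r s c hx ⟨h1, h2⟩
    have hvec : X.vec r s c ∈ LinearMap.range φ :=
      add_mem (add_mem
        (sum_mem fun i _ => sum_mem fun j _ => Submodule.smul_mem _ _ (hmem _))
        (sum_mem fun j _ => Submodule.smul_mem _ _ (hmem _)))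
        (Submodule.smul_mem _ _ hk)
    rw [hx] at hvec
    -- Primitivity brings the half back into `S`, where admissibility excludes it.
    obtain ⟨e, rfl⟩ := hprim 2 x two_ne_zero hvec
    refine (hadm e).1 ⟨by rw [← hφ, h1], ?_⟩
    rw [← hφ]
    exact h2
  have h4 : (4 : ℤ) ∣ 2 * n := by
    have := X.four_dvd_degree hX hd
    have h5 : formK3 X.h X.h = 2 * n := hg none none
    rwa [h5] at this
  obtain ⟨m, hm⟩ := hn
  omega

end K3Graphs

theorem mainTheorem10 :
    ∀ d : ℤ, 1 < d → Odd d → ∃ N : ℤ, ∀ n : ℤ, N ≤ n → Odd n →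
      ¬ K3Graphs.graph5A3plus2A1.Subgeometric (2 * n) d :=
  -- The parity obstruction needs no lower bound on `n`, so `0` is an arbitrary choice.
  fun _ _ hd => ⟨0, fun _ _ hn => K3Graphs.graph5A3plus2A1_not_subgeometric hd hn⟩
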